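/- Let $0<\gamma\le 2$, $\alpha=(4-3\gamma)/\sqrt6$, and let $V:\mathbb R\to\mathbb R$ be of class $C^2$ with only finitely many critical points. Put $$W(\phi,y,\rho,H)=H^2-\tfrac13\left(\tfrac12y^2+V(\phi)+\rho\right)$$ and consider the system $$\dot\phi=y,\qquad \dot y=-3Hy-V'(\phi)+\alpha\rho,\qquad \dot\rho=-3\gamma\rho H-\alpha\rho y,\qquad \dot H=-\tfrac12y^2-\tfrac{\gamma}{2}\rho-W$$ for flat and negatively curved Friedmann–Robertson–Walker cosmologies with a fluid coupled to a scalar field (by the Friedmann equation, $W=-k/a^2$, so that $W=0$ for $k=0$ and $W>0$ for $k=-1$). Let $\phi_*$ be a strict local minimum point of $V$, possibly degenerate, with $V(\phi_*)\ge 0$, and let $\mathbf p_*=(\phi_*,0,0,\sqrt{V(\phi_*)/3})$. Then $\mathbf p_*$ is an asymptotically stable equilibrium with respect to initial data in $$S=\{(\phi,y,\rho,H):\ \rho\ge0,\ H\ge0,\ W\ge0\}.$$ That is: $\mathbf p_*\in S$ is an equilibrium; for every neighbourhood $U$ of $\mathbf p_*$ there is a neighbourhood $N$ of $\mathbf p_*$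 such that from every initial datum in $N\cap S$ at $t=0$ there is a solution defined for all $t\ge0$, and every solution with that initial datum on $[0,T)$, $0<T\le\infty$, stays in $U$; and there is a neighbourhood $N$ of $\mathbf p_*$ such that every solution on $[0,\infty)$ with initial datum in $N\cap S$ converges to $\mathbf p_*$ as $t\to+\infty$. -/

import Mathlib

open Filter Topology Set

noncomputable section

/-- `x` is a solution of the autonomous equation `x' = F x` on the time set `I`, starting at `x₀` at
time `0`. At the end point `0` of `I = [0, T)` or `I = [0, ∞)` the derivative is one-sided. -/
def IsSolutionFrom {E : Type*} [NormedAddCommGroup E] [NormedSpace ℝ E]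
    (F : E → E) (x₀ : E) (x : ℝ → E) (I : Set ℝ) : Prop :=
  x 0 = x₀ ∧ IsIntegralCurveOn x (fun _ => F) I

/-- `p` is Lyapunov stable for `x' = F x` with respect to initial data in `S`: for every
neighbourhood `U` of `p`, initial data in `S` sufficiently close to `p` launch a solution that
exists for all times `t ≥ 0`, and every solution launched from them stays in `U`, for as long as
it is defined. -/
def IsLyapunovStableOn {E : Type*} [NormedAddCommGroup E] [NormedSpace ℝ E]
    (F : E → E) (S : Set E) (p : E) : Prop :=
  ∀ U ∈ 𝓝 p, ∃ N ∈ 𝓝 p, ∀ x₀ ∈ N ∩ S,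
    (∃ x : ℝ → E, IsSolutionFrom F x₀ x (Ici 0)) ∧
    (∀ x : ℝ → E, IsSolutionFrom F x₀ x (Ici 0) → ∀ t ∈ Ici (0 : ℝ), x t ∈ U) ∧
    (∀ T > 0, ∀ x : ℝ → E, IsSolutionFrom F x₀ x (Ico 0 T) → ∀ t ∈ Ico 0 T, x t ∈ U)

/-- `p` attracts all solutions with initial data in `S` close to `p`. -/
def IsAttractiveOn {E : Type*} [NormedAddCommGroup E] [NormedSpace ℝ E]
    (F : E → E) (S : Set E) (p : E) : Prop :=
  ∃ N ∈ 𝓝 p, ∀ x₀ ∈ N ∩ S, ∀ x : ℝ → E, IsSolutionFrom F x₀ x (Ici 0) →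
    Tendsto x atTop (𝓝 p)

/-- `p` is an asymptotically stable equilibrium of `x' = F x` with respect to initial data in the
set `S`, which contains `p`. -/
def IsAsymptoticallyStableEquilibriumOn {E : Type*} [NormedAddCommGroup E] [NormedSpace ℝ E]
    (F : E → E) (S : Set E) (p : E) : Prop :=
  p ∈ S ∧ F p = 0 ∧ IsLyapunovStableOn F S p ∧ IsAttractiveOn F S p

namespace FRW

/-- The state `(φ, y, ρ, H)`: scalar field, its time derivative, fluid density, Hubble function. -/
abbrev State : Type := ℝ × ℝ × ℝ × ℝ

/-- The coupling coefficient `α = (4 - 3γ) / √6`. -/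
def coupling (γ : ℝ) : ℝ := (4 - 3 * γ) / √6

/-- `W = H² - (y²/2 + V(φ) + ρ)/3`. By the Friedmann equation `W = -k/a²`. -/
def W (V : ℝ → ℝ) : State → ℝ
  | (φ, y, ρ, H) => H ^ 2 - (1 / 2 * y ^ 2 + V φ + ρ) / 3

/-- The vector field of the coupled system. The last component is the Raychaudhuri equation
`H' = -y²/2 - γρ/2 + k/a²`, with `k/a²` expressed through `-W`. -/
def field (V : ℝ → ℝ) (γ : ℝ) : State → State
  | (φ, y, ρ, H) =>
    (y,
      -3 * H * y - deriv V φ + coupling γ * ρ,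
      -3 * γ * ρ * H - coupling γ * ρ * y,
      -(1 / 2) * y ^ 2 - γ / 2 * ρ - W V (φ, y, ρ, H))

/-- The initial states of cosmologies with nonnegative fluid density that are not contracting, in
the flat or open topologies (`W = 0` for `k = 0`, and `W > 0` for `k = -1`). The boundary `H = 0`
is kept so that the equilibrium belongs to the set also when the minimum of `V` is zero. -/
def flatOrOpenExpanding (V : ℝ → ℝ) : Set State :=
  {s | 0 ≤ s.2.2.1 ∧ 0 ≤ s.2.2.2 ∧ 0 ≤ W V s}

end FRW

end

/-! The Hubble function is the Lyapunov function. Write `V*` for the minimum value and `H* =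
√(V*/3)`. The definition of `W` rearranges to `y²/2 + ρ + (V(φ) - V*) + 3W = 3(H² - H*²)`. Near the
equilibrium, where the invariance of `ρ ≥ 0` and `W ≥ 0` makes every term on the left nonnegative,
`H` is at least `H*` and `H' = -y²/2 - γρ/2 - W ≤ 0`. Hence the right side, small at the start,
stays small and bounds `y`, `ρ` and the height of `φ` in the well: this is stability (`invariants`,
`exists_trapping`).

For attraction, `H` is monotone and bounded, so it converges, and Barbalat's lemma gives `H' → 0`;
the terms of `H'` have one sign, so `y`, `ρ` and `W` tend to zero. Barbalat's lemma applied to `y`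
gives `y' → 0`, hence `V'(φ) → 0`. The only critical point in the well is the minimum, so `φ`
converges to it, and `W → 0` then fixes the limit of `H`. No nondegeneracy of the minimum is needed.
-/

/-! ### Comparison, continuation, Barbalat's lemma and global existence -/

/-- A function whose derivative is at least a constant multiple of it wherever it is negative stays
nonnegative. -/
theorem nonneg_of_mul_le_deriv_of_neg {u u' : ℝ → ℝ} {T C : ℝ}
    (hu : ∀ t ∈ Icc 0 T, HasDerivWithinAt u (u' t) (Icc 0 T) t) (h0 : 0 ≤ u 0)
    (hb : ∀ t ∈ Icc 0 T, u t < 0 → C * u t ≤ u' t) : ∀ t ∈ Icc 0 T, 0 ≤ u t := by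
  -- Where `-u` meets the exponential, its slope is at most `C` times the common value; the extra
  -- `1` in the rate makes the comparison strict.
  have key : ∀ ε > 0, ∀ t ∈ Icc 0 T, -u t ≤ ε * Real.exp ((C + 1) * t) := by
    intro ε hε
    refine image_le_of_deriv_right_lt_deriv_boundary (f' := fun t => -u' t)
      (B' := fun t => ε * (Real.exp ((C + 1) * t) * (C + 1))) ?_ ?_ ?_ ?_ ?_
    · exact fun t ht => (hu t ht).continuousWithinAt.neg
    · intro t ht
      exact ((hu t (Ico_subset_Icc_self ht)).mono_of_mem_nhdsWithin
        (Icc_mem_nhdsGE_of_mem ht)).neg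
    · simp; linarith
    · intro t
      have := (((hasDerivAt_id t).const_mul (C + 1)).exp).const_mul ε
      simpa using this
    · intro t ht h
      have hpos : 0 < ε * Real.exp ((C + 1) * t) := by positivity
      have := hb t (Ico_subset_Icc_self ht) (by linarith)
      have hu : u t = -(ε * Real.exp ((C + 1) * t)) := by linarith
      rw [hu] at this
      linarith
  intro t ht
  by_contra! hneg
  have he := Real.exp_pos ((C + 1) * t)
  -- This `ε` turns the bound at time `t` into `-u t ≤ -u t / 2`.
  have := key (-u t / 2 / Real.exp ((C + 1) * t)) (by
    apply div_pos _ he; linarith) t ht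
  rw [div_mul_cancel₀ _ he.ne'] at this
  linarith

/-- A continuous path which starts in an open set `U` inside the closed set `K`, and which is in `U`
at each time up to which it has been in `K`, never leaves `U`. -/
theorem mem_of_forall_mem_closed_imp_mem_open {E : Type*} [TopologicalSpace E] {U K : Set E}
    (hU : IsOpen U) (hK : IsClosed K) (hUK : U ⊆ K) {x : ℝ → E} {T : ℝ}
    (hx : ContinuousOn x (Icc 0 T)) (h0 : x 0 ∈ U)
    (h : ∀ t ∈ Icc 0 T, (∀ s ∈ Icc 0 t, x s ∈ K) → x t ∈ U) : ∀ t ∈ Icc 0 T, x t ∈ U := by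
  have hsub : Icc 0 T ⊆ x ⁻¹' K := by
    refine IsClosed.Icc_subset_of_forall_mem_nhdsGT_of_Icc_subset ?_ (hUK h0) ?_
    · rw [inter_comm]
      exact hx.preimage_isClosed_of_isClosed isClosed_Icc hK
    · intro t ht hs
      have htU := h t (Ico_subset_Icc_self ht) hs
      have h1 : x ⁻¹' U ∈ 𝓝[Icc 0 T] t :=
        hx t (Ico_subset_Icc_self ht) (hU.mem_nhds htU)
      have h2 : x ⁻¹' U ∈ 𝓝[>] t :=
        nhdsWithin_le_of_mem (Icc_mem_nhdsGT_of_mem ht) h1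
      exact mem_of_superset h2 fun s hs => hUK hs
  exact fun t ht => h t ht fun s hs => hsub ⟨hs.1, hs.2.trans ht.2⟩

/-- **Barbalat's lemma**: if a function on `[0, ∞)` converges and its derivative is Lipschitz, then
the derivative tends to zero. -/
theorem tendsto_deriv_zero_of_tendsto_of_lipschitz {f g : ℝ → ℝ} {L C : ℝ}
    (hf : ∀ t ∈ Ici (0 : ℝ), HasDerivWithinAt f (g t) (Ici 0) t)
    (hg : ∀ s ∈ Ici (0 : ℝ), ∀ t ∈ Ici (0 : ℝ), |g t - g s| ≤ C * |t - s|)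
    (hL : Tendsto f atTop (𝓝 L)) : Tendsto g atTop (𝓝 0) := by
  have hC : 0 ≤ C := by
    have := (abs_nonneg _).trans (hg 0 (by simp) 1 (by simp))
    simpa using this
  -- First-order Taylor estimate; a value `g t` of size `ε` would force `f` to change by a fixed
  -- amount over a fixed time `h`.
  have step : ∀ t ∈ Ici (0 : ℝ), ∀ h > 0, |f (t + h) - f t - h * g t| ≤ C * h * h := by
    intro t ht h hh
    have ht' : (0 : ℝ) ≤ t := ht
    have hd : ∀ s ∈ Icc t (t + h),
        HasDerivWithinAt (fun s => f s - s * g t) (g s - g t) (Icc t (t + h)) s := by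
      intro s hs
      have h1 := (hf s (ht'.trans hs.1)).mono
        (show Icc t (t + h) ⊆ Ici 0 from fun _ hu => ht'.trans hu.1)
      have h2 := ((hasDerivAt_id s).mul_const (g t)).hasDerivWithinAt (s := Icc t (t + h))
      exact (h1.sub h2).congr_deriv (by rw [one_mul])
    have := (convex_Icc t (t + h)).norm_image_sub_le_of_norm_hasDerivWithin_le (C := C * h) hd
      (fun s hs => by
        rw [Real.norm_eq_abs]
        refine (hg t ht s (ht'.trans hs.1)).trans ?_
        gcongr
        rw [abs_of_nonneg (by linarith [hs.1])]
        linarith [hs.2]) (left_mem_Icc.2 (by linarith)) (right_mem_Icc.2 (by linarith))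
    rw [Real.norm_eq_abs, Real.norm_eq_abs, add_sub_cancel_left, abs_of_pos hh] at this
    convert this using 2
    ring
  rw [Metric.tendsto_atTop]
  intro ε hε
  set h : ℝ := ε / (2 * (C + 1)) with hh
  have hpos : 0 < h := by positivity
  have hCh : C * h < ε / 2 := by
    have : (C + 1) * h = ε / 2 := by rw [hh]; field_simp
    linarith
  obtain ⟨N, hN⟩ := Metric.tendsto_atTop.1 hL (h * (ε / 4)) (by positivity)
  refine ⟨max N 0, fun t ht => ?_⟩
  have htN : N ≤ t := (le_max_left _ _).trans ht
  have ht0 : 0 ≤ t := (le_max_right _ _).trans ht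
  have h1 := abs_lt.1 (hN t htN)
  have h2 := abs_lt.1 (hN (t + h) (by linarith))
  have h3 := abs_le.1 (step t ht0 h hpos)
  rw [Real.dist_eq, sub_zero, abs_lt]
  constructor
  · refine lt_of_mul_lt_mul_left (a := h) ?_ hpos.le
    nlinarith [mul_lt_mul_of_pos_left hCh hpos]
  · refine lt_of_mul_lt_mul_left (a := h) ?_ hpos.le
    nlinarith [mul_lt_mul_of_pos_left hCh hpos]

/-- A path in a compact set converges to a point if some continuous function which has no other zero
in the set tends to zero along the path. -/
theorem IsCompact.tendsto_of_tendsto_zero {X ι : Type*} [TopologicalSpace X] {K : Set X}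
    (hK : IsCompact K) {f : X → ℝ} (hf : Continuous f) {a : X} (hfa : ∀ y ∈ K, f y = 0 → y = a)
    {l : Filter ι} {u : ι → X} (hu : ∀ᶠ i in l, u i ∈ K)
    (h : Tendsto (fun i => f (u i)) l (𝓝 0)) : Tendsto u l (𝓝 a) := by
  refine hK.tendsto_nhds_of_unique_mapClusterPt hu fun y hy hc => hfa y hy ?_
  have h1 : MapClusterPt (f y) l (fun i => f (u i)) := hc.continuousAt_comp hf.continuousAt
  have h2 : ClusterPt (f y) (𝓝 0) := ClusterPt.mono h1 h
  exact eq_of_nhds_neBot h2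

open scoped NNReal in
/-- A bounded Lipschitz vector field has solutions for all positive times. -/
theorem LipschitzWith.exists_isSolutionFrom {E : Type*} [NormedAddCommGroup E] [NormedSpace ℝ E]
    [CompleteSpace E] {G : E → E} {K L : ℝ≥0} (hG : LipschitzWith K G) (hb : ∀ x, ‖G x‖ ≤ L)
    (x₀ : E) : ∃ x : ℝ → E, IsSolutionFrom G x₀ x (Ici 0) := by
  have local_ex : ∀ n : ℕ, ∃ x : ℝ → E, x 0 = x₀ ∧
      ∀ t ∈ Icc (0 : ℝ) n, HasDerivWithinAt x (G (x t)) (Icc 0 n) t := by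
    intro n
    -- A ball of radius `L * n` cannot be left before time `n`, so the global bound removes any
    -- smallness condition on the time.
    have hPL : IsPicardLindelof (fun _ => G) (tmin := 0) (tmax := n)
        ⟨0, le_rfl, n.cast_nonneg⟩ x₀ (L * n) 0 L K :=
      .of_time_independent (fun x _ => hb x) hG.lipschitzOnWith (by simp)
    exact hPL.exists_eq_forall_mem_Icc_hasDerivWithinAt₀
  choose x hx0 hx using local_ex
  have cont : ∀ n : ℕ, ContinuousOn (x n) (Icc 0 n) := fun n t ht => (hx n t ht).continuousWithinAt
  have right : ∀ n : ℕ, ∀ t ∈ Ico (0 : ℝ) n, HasDerivWithinAt (x n) (G (x n t)) (Ici t) t :=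
    fun n t ht => (hx n t (Ico_subset_Icc_self ht)).mono_of_mem_nhdsWithin
      (Icc_mem_nhdsGE_of_mem ht)
  have agree : ∀ m n : ℕ, m ≤ n → EqOn (x m) (x n) (Icc 0 m) := by
    intro m n hmn
    have hmn' : (m : ℝ) ≤ n := by exact_mod_cast hmn
    exact ODE_solution_unique (v := fun _ => G) (fun _ => hG) (cont m) (right m)
      ((cont n).mono (Icc_subset_Icc_right hmn'))
      (fun t ht => right n t ⟨ht.1, ht.2.trans_le hmn'⟩) (by rw [hx0, hx0])
  refine ⟨fun t => x ⌈t⌉₊ t, by simpa using hx0 0, fun t ht => ?_⟩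
  have ht' : (0 : ℝ) ≤ t := ht
  have eq : ∀ n : ℕ, ∀ s ∈ Icc (0 : ℝ) n, x ⌈s⌉₊ s = x n s := fun n s hs =>
    agree _ _ (Nat.ceil_le.2 hs.2) ⟨hs.1, Nat.le_ceil s⟩
  -- The next integer is used so that `t` is not the right end point, where the derivative would
  -- only be one-sided.
  have hlt : t < (⌈t⌉₊ + 1 : ℕ) := by push_cast; linarith [Nat.le_ceil t]
  have htm : t ∈ Icc (0 : ℝ) (⌈t⌉₊ + 1 : ℕ) := ⟨ht', hlt.le⟩
  have hd := (hx (⌈t⌉₊ + 1) t htm).congr (fun s hs => eq _ s hs) (eq _ t htm)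
  rw [← eq _ t htm] at hd
  refine hd.mono_of_mem_nhdsWithin ?_
  rw [← Ici_inter_Iic]
  exact inter_mem_nhdsWithin _ (Iic_mem_nhds hlt)

/-! ### The vector field, the potential well and the energy balance -/

namespace FRW

variable {V : ℝ → ℝ} {γ φs r T : ℝ}

theorem contDiff_field (hV : ContDiff ℝ 2 V) : ContDiff ℝ 1 (field V γ) := by
  have hV1 : ContDiff ℝ 1 V := hV.of_le (by norm_num)
  have hV' : ContDiff ℝ 1 (deriv V) := (contDiff_succ_iff_deriv (n := 1).1 hV).2.2
  change ContDiff ℝ 1 fun s : State => (s.2.1, -3 * s.2.2.2 * s.2.1 - deriv V s.1 +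
    coupling γ * s.2.2.1, -3 * γ * s.2.2.1 * s.2.2.2 - coupling γ * s.2.2.1 * s.2.1,
    -(1 / 2) * s.2.1 ^ 2 - γ / 2 * s.2.2.1 -
      (s.2.2.2 ^ 2 - (1 / 2 * s.2.1 ^ 2 + V s.1 + s.2.2.1) / 3))
  fun_prop

open scoped NNReal in
/-- The vector field agrees near any point with a bounded Lipschitz vector field. -/
theorem exists_bounded_lipschitz_eqOn_field (hV : ContDiff ℝ 2 V) (p : State) (hr : 0 < r) :
    ∃ (G : State → State) (K L : ℝ≥0), LipschitzWith K G ∧ (∀ x, ‖G x‖ ≤ L) ∧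
      EqOn G (field V γ) (Metric.closedBall p r) := by
  let b : ContDiffBump p := ⟨r, r + 1, hr, by linarith⟩
  have hc : ContDiff ℝ 1 fun x => b x • field V γ x := b.contDiff.smul (contDiff_field hV)
  have hs : HasCompactSupport fun x => b x • field V γ x := b.hasCompactSupport.smul_right
  obtain ⟨K, hK⟩ := hc.lipschitzWith_of_hasCompactSupport hs one_ne_zero
  obtain ⟨L, hL⟩ := hc.continuous.bounded_above_of_compact_support hs
  refine ⟨_, K, L.toNNReal, hK, fun x => (hL x).trans (Real.le_coe_toNNReal L), fun x hx => ?_⟩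
  simp [b.one_of_mem_closedBall hx]

section Components

variable {x : ℝ → State} {v : State} {I : Set ℝ} {t : ℝ}

theorem hasDerivWithinAt_components (h : HasDerivWithinAt x v I t) :
    HasDerivWithinAt (fun s => (x s).1) v.1 I t ∧
    HasDerivWithinAt (fun s => (x s).2.1) v.2.1 I t ∧
    HasDerivWithinAt (fun s => (x s).2.2.1) v.2.2.1 I t ∧
    HasDerivWithinAt (fun s => (x s).2.2.2) v.2.2.2 I t := by
  have fst {E F : Type} [NormedAddCommGroup E] [NormedSpace ℝ E] [NormedAddCommGroup F]
      [NormedSpace ℝ F] {z : ℝ → E × F} {w : E × F} (h : HasDerivWithinAt z w I t) :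
      HasDerivWithinAt (fun s => (z s).1) w.1 I t :=
    (ContinuousLinearMap.fst ℝ E F).hasFDerivAt.comp_hasDerivWithinAt t h
  have snd {E F : Type} [NormedAddCommGroup E] [NormedSpace ℝ E] [NormedAddCommGroup F]
      [NormedSpace ℝ F] {z : ℝ → E × F} {w : E × F} (h : HasDerivWithinAt z w I t) :
      HasDerivWithinAt (fun s => (z s).2) w.2 I t :=
    (ContinuousLinearMap.snd ℝ E F).hasFDerivAt.comp_hasDerivWithinAt t h
  exact ⟨fst h, fst (snd h), fst (snd (snd h)), snd (snd (snd h))⟩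

/-- Along solutions, `W' = -2 H W`. -/
theorem hasDerivWithinAt_W (hV : Differentiable ℝ V)
    (h : HasDerivWithinAt x (field V γ (x t)) I t) :
    HasDerivWithinAt (fun s => W V (x s)) (-2 * (x t).2.2.2 * W V (x t)) I t := by
  obtain ⟨h1, h2, h3, h4⟩ := hasDerivWithinAt_components h
  have hVd := (hV (x t).1).hasDerivAt.comp_hasDerivWithinAt t h1
  have := (h4.pow 2).sub (((((h2.pow 2).const_mul (1 / 2)).add hVd).add h3).div_const 3)
  refine this.congr_deriv ?_
  simp only [field, W]
  ring

end Components

/-- `φs` is the only critical point and the strict minimum point of `V` within distance `r`. -/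
def IsWell (V : ℝ → ℝ) (φs r : ℝ) : Prop :=
  ∀ φ, |φ - φs| ≤ r → φ ≠ φs → V φs < V φ ∧ deriv V φ ≠ 0

theorem IsWell.le (h : IsWell V φs r) {φ : ℝ} (hφ : |φ - φs| ≤ r) : V φs ≤ V φ := by
  rcases eq_or_ne φ φs with rfl | hne
  exacts [le_rfl, (h φ hφ hne).1.le]

/-- Finiteness makes the set of the other critical points closed, so a neighbourhood of `φs` avoids
it. -/
theorem exists_isWell (hcrit : {φ : ℝ | deriv V φ = 0}.Finite)
    (hmin : ∀ᶠ φ in 𝓝[≠] φs, V φs < V φ) : ∃ r > 0, IsWell V φs r := by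
  have h1 : ∀ᶠ φ in 𝓝[≠] φs, deriv V φ ≠ 0 := by
    have hcl : IsClosed ({φ : ℝ | deriv V φ = 0} \ {φs}) := hcrit.sdiff.isClosed
    have : ({φ : ℝ | deriv V φ = 0} \ {φs})ᶜ ∈ 𝓝 φs := hcl.isOpen_compl.mem_nhds (by simp)
    filter_upwards [mem_nhdsWithin_of_mem_nhds this, self_mem_nhdsWithin] with φ h h' h0
    exact h ⟨h0, h'⟩
  obtain ⟨r, hr, h⟩ := (nhdsWithin_hasBasis Metric.nhds_basis_closedBall _).eventually_iff.1
    (hmin.and h1)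
  exact ⟨r, hr, fun φ hφ hne => h ⟨by simpa [Real.dist_eq] using hφ, hne⟩⟩

theorem IsWell.mono (h : IsWell V φs r) {r' : ℝ} (hr : r' ≤ r) : IsWell V φs r' :=
  fun φ hφ => h φ (hφ.trans hr)

/-- The equilibrium with scalar field `φs`. -/
noncomputable def equilibrium (V : ℝ → ℝ) (φs : ℝ) : State := (φs, 0, 0, √(V φs / 3))

theorem mem_closedBall_equilibrium {s : State} :
    s ∈ Metric.closedBall (equilibrium V φs) r ↔
      |s.1 - φs| ≤ r ∧ |s.2.1| ≤ r ∧ |s.2.2.1| ≤ r ∧ |s.2.2.2 - √(V φs / 3)| ≤ r := by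
  simp [equilibrium, Prod.dist_eq, Real.dist_eq]

theorem mem_ball_equilibrium {s : State} :
    s ∈ Metric.ball (equilibrium V φs) r ↔
      |s.1 - φs| < r ∧ |s.2.1| < r ∧ |s.2.2.1| < r ∧ |s.2.2.2 - √(V φs / 3)| < r := by
  simp [equilibrium, Prod.dist_eq, Real.dist_eq]

/-- The energy balance relative to the equilibrium. -/
theorem energy_balance {s : State} (hnonneg : 0 ≤ V φs) :
    1 / 2 * s.2.1 ^ 2 + s.2.2.1 + (V s.1 - V φs) + 3 * W V s =
      3 * (s.2.2.2 ^ 2 - √(V φs / 3) ^ 2) := by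
  rw [Real.sq_sqrt (by positivity)]
  simp only [W]
  ring

theorem sqrt_le_hubble (hnonneg : 0 ≤ V φs) (hw : IsWell V φs r) {s : State}
    (hs : s ∈ Metric.closedBall (equilibrium V φs) r) (hS : s ∈ flatOrOpenExpanding V) :
    √(V φs / 3) ≤ s.2.2.2 := by
  obtain ⟨hρ, hH, hW⟩ := hS
  have h1 := hw.le (mem_closedBall_equilibrium.1 hs).1
  have h2 := energy_balance (s := s) hnonneg
  refine abs_le_of_sq_le_sq' ?_ hH |>.2
  nlinarith [sq_nonneg s.2.1]

/-! ### Invariant region and trapping -/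

/-- As long as a solution starting in `flatOrOpenExpanding V` is close to the equilibrium, it stays
in this set, and its Hubble function remains between its equilibrium and its initial values. -/
theorem invariants (hV : Differentiable ℝ V) (hγ : 0 < γ) (hγ' : γ ≤ 2) (hnonneg : 0 ≤ V φs)
    (hr : 0 < r) (hw : IsWell V φs r) {x : ℝ → State}
    (hx : ∀ t ∈ Icc 0 T, HasDerivWithinAt x (field V γ (x t)) (Icc 0 T) t)
    (hK : ∀ t ∈ Icc 0 T, x t ∈ Metric.closedBall (equilibrium V φs) r)
    (h0 : x 0 ∈ flatOrOpenExpanding V) (hT : 0 ≤ T) :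
    ∀ t ∈ Icc 0 T, 0 ≤ (x t).2.2.1 ∧ 0 ≤ W V (x t) ∧ √(V φs / 3) ≤ (x t).2.2.2 ∧
      (x t).2.2.2 ≤ (x 0).2.2.2 := by
  set Hs := √(V φs / 3) with hHs
  have hHs0 : 0 ≤ Hs := Real.sqrt_nonneg _
  have bd := fun t ht => mem_closedBall_equilibrium.1 (hK t ht)
  have hH0 : Hs ≤ (x 0).2.2.2 := sqrt_le_hubble hnonneg hw (hK 0 ⟨le_rfl, hT⟩) h0
  have hρ : ∀ t ∈ Icc 0 T, 0 ≤ (x t).2.2.1 := by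
    -- `C` bounds the logarithmic rate `-3γH - αy` on the ball, without using the sign of `H`.
    refine nonneg_of_mul_le_deriv_of_neg (C := 3 * γ * (Hs + r) + |coupling γ| * r)
      (fun t ht => (hasDerivWithinAt_components (hx t ht)).2.2.1) h0.1 fun t ht hneg => ?_
    obtain ⟨-, hy, -, hH⟩ := bd t ht
    have h1 : -(coupling γ * (x t).2.1) ≤ |coupling γ| * r := by
      refine (neg_le_abs _).trans ?_
      rw [abs_mul]
      gcongr
    have h2 : -(x t).2.2.2 ≤ Hs + r := by linarith [(abs_le.1 hH).1]
    have h3 := mul_le_mul_of_nonneg_left h2 (show 0 ≤ 3 * γ by positivity)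
    change _ ≤ -3 * γ * (x t).2.2.1 * (x t).2.2.2 - coupling γ * (x t).2.2.1 * (x t).2.1
    nlinarith
  have hW : ∀ t ∈ Icc 0 T, 0 ≤ W V (x t) := by
    refine nonneg_of_mul_le_deriv_of_neg (C := 2 * (Hs + r))
      (fun t ht => hasDerivWithinAt_W hV (hx t ht)) h0.2.2 fun t ht hneg => ?_
    have h2 : -(x t).2.2.2 ≤ Hs + r := by linarith [(abs_le.1 (bd t ht).2.2.2).1]
    nlinarith
  have hder : ∀ t, (field V γ (x t)).2.2.2 =
      -(1 / 2) * (x t).2.1 ^ 2 - γ / 2 * (x t).2.2.1 - W V (x t) := fun t => rfl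
  have hH : ∀ t ∈ Icc 0 T, 0 ≤ (x t).2.2.2 - Hs := by
    -- By `γ ≤ 2` and the energy balance, `-H' ≤ 3(H - H*)(H + H*)`, and `H + H* ≥ -r` on the ball;
    -- so `3r` would already do. This covers `H* = 0`, where `H` must not turn negative.
    refine nonneg_of_mul_le_deriv_of_neg (C := 4 * r)
      (fun t ht => ((hasDerivWithinAt_components (hx t ht)).2.2.2).sub_const Hs)
      (by linarith) fun t ht hneg => ?_
    have h1 := energy_balance (s := x t) hnonneg
    have h2 := hw.le (bd t ht).1
    have h3 : 0 ≤ (x t).2.2.2 + Hs + r := by linarith [(abs_le.1 (bd t ht).2.2.2).1]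
    have h4 := mul_nonneg (sub_nonneg.2 hγ') (hρ t ht)
    have h5 := hW t ht
    have h6 := hρ t ht
    rw [hder]
    nlinarith [sq_nonneg (x t).2.1]
  have hmono : ∀ t ∈ Icc 0 T, 0 ≤ (x 0).2.2.2 - (x t).2.2.2 := by
    refine nonneg_of_mul_le_deriv_of_neg (C := 0)
      (fun t ht => ((hasDerivWithinAt_components (hx t ht)).2.2.2).const_sub _)
      (by simp) fun t ht hneg => ?_
    have h4 := mul_nonneg hγ.le (hρ t ht)
    rw [hder]
    nlinarith [sq_nonneg (x t).2.1, hW t ht]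
  exact fun t ht => ⟨hρ t ht, hW t ht, sub_nonneg.1 (hH t ht), sub_nonneg.1 (hmono t ht)⟩

/-- Solutions starting in `flatOrOpenExpanding V` close to the equilibrium stay close to it, and
stay in this set. The vector field matters only close to the equilibrium. -/
theorem exists_trapping (hV : Differentiable ℝ V) (hγ : 0 < γ) (hγ' : γ ≤ 2)
    (hnonneg : 0 ≤ V φs) (hr : 0 < r) (hw : IsWell V φs r) :
    ∃ N ∈ 𝓝 (equilibrium V φs), ∀ x₀ ∈ N ∩ flatOrOpenExpanding V, ∀ G : State → State,
      EqOn G (field V γ) (Metric.closedBall (equilibrium V φs) r) →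
      ∀ (T : ℝ) (x : ℝ → State), IsSolutionFrom G x₀ x (Icc 0 T) → ∀ t ∈ Icc 0 T,
        x t ∈ Metric.ball (equilibrium V φs) r ∧ 0 ≤ (x t).2.2.1 ∧ 0 ≤ W V (x t) ∧
          √(V φs / 3) ≤ (x t).2.2.2 := by
  set Hs := √(V φs / 3) with hHs
  -- With the energy below `δ`, the four bounds keep `ρ < r`, `y²/2 < r²/2`, and `φ` away from `φs +
  -- r` and `φs - r`.
  obtain ⟨δ, hδ, hδr, hδr2, hδ1, hδ2⟩ : ∃ δ > 0, δ ≤ r ∧ δ ≤ r ^ 2 / 2 ∧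
      δ ≤ V (φs + r) - V φs ∧ δ ≤ V (φs - r) - V φs := by
    have h1 := (hw (φs + r) (by simp [abs_of_pos hr]) (by linarith)).1
    have h2 := (hw (φs - r) (by simp [abs_of_pos hr]) (by linarith)).1
    refine ⟨min (min r (r ^ 2 / 2)) (min (V (φs + r) - V φs) (V (φs - r) - V φs)), ?_, ?_⟩
    · refine lt_min (lt_min hr (by positivity)) (lt_min ?_ ?_) <;> linarith
    · simp
  refine ⟨Metric.ball (equilibrium V φs) r ∩
    {s | 3 * (s.2.2.2 ^ 2 - Hs ^ 2) < δ}, ?_, ?_⟩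
  · refine inter_mem (Metric.ball_mem_nhds _ hr) (IsOpen.mem_nhds ?_ ?_)
    · exact isOpen_lt (by fun_prop) continuous_const
    · simpa [equilibrium, hHs] using hδ
  rintro x₀ ⟨⟨hb, hs⟩, hS⟩ G hG T x ⟨hx0, hx⟩
  rw [← hx0] at hb hs hS
  have main : ∀ t ∈ Icc 0 T,
      (∀ s ∈ Icc 0 t, x s ∈ Metric.closedBall (equilibrium V φs) r) →
      x t ∈ Metric.ball (equilibrium V φs) r ∧ 0 ≤ (x t).2.2.1 ∧ 0 ≤ W V (x t) ∧
          Hs ≤ (x t).2.2.2 := by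
    intro t ht hK
    have hsub : Icc 0 t ⊆ Icc 0 T := Icc_subset_Icc_right ht.2
    have htt : t ∈ Icc 0 t := ⟨ht.1, le_rfl⟩
    obtain ⟨hρ, hW, hH, hmono⟩ := invariants hV hγ hγ' hnonneg hr hw (T := t) (x := x)
      (fun s hs => by
        rw [← hG (hK s hs)]
        exact (hx s (hsub hs)).mono hsub) hK hS ht.1 t htt
    refine ⟨?_, hρ, hW, hH⟩
    obtain ⟨b1, b2, b3, b4⟩ := mem_closedBall_equilibrium.1 (hK t htt)
    have he := energy_balance (s := x t) hnonneg
    have hHs0 : 0 ≤ Hs := Real.sqrt_nonneg _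
    have hsq : (x t).2.2.2 ^ 2 ≤ (x 0).2.2.2 ^ 2 :=
      pow_le_pow_left₀ (hHs0.trans hH) hmono 2
    have hwell := hw.le b1
    have hs' : 3 * ((x 0).2.2.2 ^ 2 - Hs ^ 2) < δ := hs
    have hy2 := sq_nonneg (x t).2.1
    have hb4 := (mem_ball_equilibrium.1 hb).2.2.2
    refine mem_ball_equilibrium.2 ⟨?_, ?_, ?_, ?_⟩
    · refine lt_of_le_of_ne b1 fun heq => ?_
      rcases eq_or_eq_neg_of_abs_eq heq with h | h
      · have : (x t).1 = φs + r := by linarith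
        rw [this] at he
        linarith
      · have : (x t).1 = φs - r := by linarith
        rw [this] at he
        linarith
    · refine abs_lt_of_sq_lt_sq ?_ hr.le
      linarith
    · rw [abs_of_nonneg hρ]
      linarith
    · rw [abs_lt] at hb4 ⊢
      constructor <;> linarith
  have hball := mem_of_forall_mem_closed_imp_mem_open Metric.isOpen_ball
    Metric.isClosed_closedBall Metric.ball_subset_closedBall
    (fun t ht => (hx t ht).continuousWithinAt) hb fun t ht h => (main t ht h).1
  exact fun t ht => main t ht fun s hs =>
    Metric.ball_subset_closedBall (hball s ⟨hs.1, hs.2.trans ht.2⟩)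

/-! ### Stability and attraction -/

theorem isLyapunovStableOn (hV : ContDiff ℝ 2 V) (hcrit : {φ : ℝ | deriv V φ = 0}.Finite)
    (hγ : 0 < γ) (hγ' : γ ≤ 2) (hmin : ∀ᶠ φ in 𝓝[≠] φs, V φs < V φ) (hnonneg : 0 ≤ V φs) :
    IsLyapunovStableOn (field V γ) (flatOrOpenExpanding V) (equilibrium V φs) := by
  intro U hU
  obtain ⟨r₁, hr₁, hw₁⟩ := exists_isWell hcrit hmin
  obtain ⟨r₂, hr₂, hU₂⟩ := Metric.mem_nhds_iff.1 hU
  set r := min r₁ r₂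
  have hr : 0 < r := lt_min hr₁ hr₂
  have hbU : Metric.ball (equilibrium V φs) r ⊆ U :=
    (Metric.ball_subset_ball (min_le_right _ _)).trans hU₂
  obtain ⟨N, hN, trap⟩ := exists_trapping (hV.differentiable (by norm_num)) hγ hγ' hnonneg hr
    (hw₁.mono (min_le_left _ _))
  have restrict : ∀ {G : State → State} {x₀ : State} {x : ℝ → State} {I J : Set ℝ},
      IsSolutionFrom G x₀ x I → J ⊆ I → IsSolutionFrom G x₀ x J :=
    fun h hJ => ⟨h.1, h.2.mono hJ⟩
  refine ⟨N, hN, fun x₀ hx₀ => ⟨?_, fun x hx t ht => ?_, fun T hT x hx t ht => ?_⟩⟩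
  · obtain ⟨G, K, L, hG, hb, hEq⟩ :=
      exists_bounded_lipschitz_eqOn_field (γ := γ) hV (equilibrium V φs) hr
    obtain ⟨x, hx⟩ := hG.exists_isSolutionFrom hb x₀
    -- Trapping also holds for the truncated field `G`, so its global solution never leaves the ball
    -- where `G` is the true field.
    refine ⟨x, hx.1, fun t ht => ?_⟩
    have := (trap x₀ hx₀ G hEq t x (restrict hx Icc_subset_Ici_self) t ⟨ht, le_rfl⟩).1
    exact (hx.2 t ht).congr_deriv (hEq (Metric.ball_subset_closedBall this))
  · exact hbU (trap x₀ hx₀ _ (fun _ _ => rfl) t x (restrict hx Icc_subset_Ici_self) t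
      ⟨ht, le_rfl⟩).1
  · exact hbU (trap x₀ hx₀ _ (fun _ _ => rfl) t x
      (restrict hx fun s hs => ⟨hs.1, hs.2.trans_lt ht.2⟩) t ⟨ht.1, le_rfl⟩).1

theorem isAttractiveOn (hV : ContDiff ℝ 2 V) (hcrit : {φ : ℝ | deriv V φ = 0}.Finite)
    (hγ : 0 < γ) (hγ' : γ ≤ 2) (hmin : ∀ᶠ φ in 𝓝[≠] φs, V φs < V φ) (hnonneg : 0 ≤ V φs) :
    IsAttractiveOn (field V γ) (flatOrOpenExpanding V) (equilibrium V φs) := by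
  obtain ⟨r, hr, hw⟩ := exists_isWell hcrit hmin
  obtain ⟨N, hN, trap⟩ := exists_trapping (hV.differentiable (by norm_num)) hγ hγ' hnonneg hr hw
  refine ⟨N, hN, fun x₀ hx₀ x hx => ?_⟩
  have hinv : ∀ t ∈ Ici (0 : ℝ), x t ∈ Metric.ball (equilibrium V φs) r ∧ 0 ≤ (x t).2.2.1 ∧
      0 ≤ W V (x t) ∧ √(V φs / 3) ≤ (x t).2.2.2 := fun t ht =>
    trap x₀ hx₀ _ (fun _ _ => rfl) t x ⟨hx.1, hx.2.mono Icc_subset_Ici_self⟩ t ⟨ht, le_rfl⟩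
  have hcb : ∀ t ∈ Ici (0 : ℝ), x t ∈ Metric.closedBall (equilibrium V φs) r :=
    fun t ht => Metric.ball_subset_closedBall (hinv t ht).1
  have comp := fun t ht => hasDerivWithinAt_components (hx.2 t ht)
  obtain ⟨G, K, L, hG, hb, hEq⟩ :=
    exists_bounded_lipschitz_eqOn_field (γ := γ) hV (equilibrium V φs) hr
  -- The Lipschitz hypothesis of Barbalat's lemma, for all components at once: the trapped path is
  -- `L`-Lipschitz and the field is `K`-Lipschitz on the ball.
  have hlip : ∀ s ∈ Ici (0 : ℝ), ∀ t ∈ Ici (0 : ℝ),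
      ‖field V γ (x t) - field V γ (x s)‖ ≤ (K * L) * |t - s| := by
    intro s hs t ht
    have h1 : ‖x t - x s‖ ≤ L * |t - s| := by
      refine (convex_Ici (0 : ℝ)).norm_image_sub_le_of_norm_hasDerivWithin_le hx.2
        (fun u hu => ?_) hs ht
      have := hb (x u)
      rwa [hEq (hcb u hu)] at this
    rw [← hEq (hcb t ht), ← hEq (hcb s hs), mul_assoc]
    exact (hG.norm_sub_le _ _).trans (by gcongr)
  have hH' : ∀ t, (field V γ (x t)).2.2.2 =
      -(1 / 2) * (x t).2.1 ^ 2 - γ / 2 * (x t).2.2.1 - W V (x t) := fun t => rfl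
  have hanti : AntitoneOn (fun t => (x t).2.2.2) (Ici 0) := by
    refine antitoneOn_of_hasDerivWithinAt_nonpos (f' := fun t => (field V γ (x t)).2.2.2)
      (convex_Ici 0) (fun t ht => (comp t ht).2.2.2.continuousWithinAt) (fun t ht => ?_)
      fun t ht => ?_
    · exact (comp t (interior_subset ht)).2.2.2.mono interior_subset
    · obtain ⟨-, h1, h2, -⟩ := hinv t (interior_subset ht)
      have := mul_nonneg hγ.le h1
      rw [hH']
      nlinarith [sq_nonneg (x t).2.1]
  -- The limit is not identified yet; only convergence is needed for Barbalat's lemma.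
  obtain ⟨H₁, hHlim⟩ : ∃ H₁, Tendsto (fun t => (x t).2.2.2) atTop (𝓝 H₁) := by
    have hanti' : Antitone fun t : ℝ => (x (max t 0)).2.2.2 := fun s t hst =>
      hanti (le_max_right s 0) (le_max_right t 0) (max_le_max_right 0 hst)
    refine ⟨_, (tendsto_atTop_ciInf hanti' ⟨√(V φs / 3), ?_⟩).congr' ?_⟩
    · rintro _ ⟨t, rfl⟩
      exact (hinv _ (le_max_right t 0)).2.2.2
    · filter_upwards [eventually_ge_atTop 0] with t ht
      rw [max_eq_left ht]
  have hH'lim : Tendsto (fun t => (field V γ (x t)).2.2.2) atTop (𝓝 0) :=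
    tendsto_deriv_zero_of_tendsto_of_lipschitz (fun t ht => (comp t ht).2.2.2)
      (fun s hs t ht => ((norm_snd_le _).trans <| (norm_snd_le _).trans <|
        norm_snd_le (field V γ (x t) - field V γ (x s))).trans (hlip s hs t ht)) hHlim
  have hpos := eventually_ge_atTop (0 : ℝ)
  have hWlim : Tendsto (fun t => W V (x t)) atTop (𝓝 0) := by
    refine squeeze_zero' (hpos.mono fun t ht => (hinv t ht).2.2.1) (hpos.mono fun t ht => ?_)
      (by simpa using hH'lim.neg)
    have := mul_nonneg hγ.le (hinv t ht).2.1
    rw [hH']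
    nlinarith [sq_nonneg (x t).2.1]
  have hρlim : Tendsto (fun t => (x t).2.2.1) atTop (𝓝 0) := by
    refine squeeze_zero' (g := fun t => 2 / γ * -(field V γ (x t)).2.2.2)
      (hpos.mono fun t ht => (hinv t ht).2.1) (hpos.mono fun t ht => ?_)
      (by simpa using (hH'lim.neg).const_mul (2 / γ))
    rw [hH', div_mul_eq_mul_div, le_div_iff₀ hγ]
    nlinarith [sq_nonneg (x t).2.1, (hinv t ht).2.2.1]
  have hylim : Tendsto (fun t => (x t).2.1) atTop (𝓝 0) := by
    refine squeeze_zero_norm' (a := fun t => √(2 * -(field V γ (x t)).2.2.2))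
      (hpos.mono fun t ht => ?_) ?_
    · refine Real.abs_le_sqrt ?_
      have := mul_nonneg hγ.le (hinv t ht).2.1
      rw [hH']
      nlinarith [(hinv t ht).2.2.1]
    · simpa using ((hH'lim.neg).const_mul 2).sqrt
  have hy'lim : Tendsto (fun t => (field V γ (x t)).2.1) atTop (𝓝 0) :=
    tendsto_deriv_zero_of_tendsto_of_lipschitz (fun t ht => (comp t ht).2.1)
      (fun s hs t ht => ((norm_fst_le _).trans <|
        norm_snd_le (field V γ (x t) - field V γ (x s))).trans (hlip s hs t ht)) hylim
  -- The equation for `y'` is solved for `V'(φ)`; all its other terms tend to zero.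
  have hV'lim : Tendsto (fun t => deriv V (x t).1) atTop (𝓝 0) := by
    have := (((hHlim.const_mul (-3)).mul hylim).add (hρlim.const_mul (coupling γ))).sub hy'lim
    simp only [mul_zero, add_zero, sub_zero] at this
    refine this.congr fun t => ?_
    simp only [field]
    ring
  have hφlim : Tendsto (fun t => (x t).1) atTop (𝓝 φs) := by
    refine (isCompact_closedBall φs r).tendsto_of_tendsto_zero
      (hV.continuous_deriv (by norm_num)) (fun φ hφ h0 => ?_) (hpos.mono fun t ht => ?_) hV'lim
    · by_contra hne
      exact (hw φ hφ hne).2 h0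
    · exact (mem_closedBall_equilibrium.1 (hcb t ht)).1
  -- Since `H ≥ 0`, the definition of `W` gives `H` as a square root of quantities whose limits are
  -- known.
  have hHlim' : Tendsto (fun t => (x t).2.2.2) atTop (𝓝 √(V φs / 3)) := by
    have hVlim : Tendsto (fun t => V (x t).1) atTop (𝓝 (V φs)) :=
      (hV.continuous.tendsto φs).comp hφlim
    have := (hWlim.add (((((hylim.pow 2).const_mul (1 / 2)).add hVlim).add hρlim).div_const
      3)).sqrt
    simp only [ne_eq, OfNat.ofNat_ne_zero, not_false_eq_true, zero_pow, mul_zero, zero_add,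
      add_zero] at this
    refine this.congr' (hpos.mono fun t ht => ?_)
    have h0 : 0 ≤ (x t).2.2.2 := (Real.sqrt_nonneg _).trans (hinv t ht).2.2.2
    refine Eq.trans ?_ (Real.sqrt_sq h0)
    congr 1
    simp only [W]
    ring
  exact hφlim.prodMk_nhds (hylim.prodMk_nhds (hρlim.prodMk_nhds hHlim'))

end FRW

theorem proposition1 (V : ℝ → ℝ) (hV : ContDiff ℝ 2 V)
    (hcrit : {φ : ℝ | deriv V φ = 0}.Finite)
    (γ : ℝ) (hγ : 0 < γ) (hγ' : γ ≤ 2)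
    (φs : ℝ) (hmin : ∀ᶠ φ in 𝓝[≠] φs, V φs < V φ) (hnonneg : 0 ≤ V φs) :
    IsAsymptoticallyStableEquilibriumOn (FRW.field V γ) (FRW.flatOrOpenExpanding V)
      (φs, 0, 0, √(V φs / 3)) := by
  have hcritical : deriv V φs = 0 := by
    refine IsLocalMin.deriv_eq_zero ?_
    filter_upwards [eventually_nhdsWithin_iff.1 hmin] with φ h
    rcases eq_or_ne φ φs with rfl | hne
    exacts [le_rfl, (h hne).le]
  have hsq := Real.sq_sqrt (show 0 ≤ V φs / 3 by positivity)
  refine ⟨⟨le_rfl, Real.sqrt_nonneg _, ?_⟩, ?_,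
    FRW.isLyapunovStableOn hV hcrit hγ hγ' hmin hnonneg,
    FRW.isAttractiveOn hV hcrit hγ hγ' hmin hnonneg⟩
  · simp only [FRW.W, hsq]
    norm_num
  · simp only [FRW.field, FRW.W, hsq, hcritical]
    norm_num
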